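/- Let $(X,d)$ be a metric space and let $n\ge 0$ be an integer. A family of subsets of $X$ is *$r$-disjoint* if $d(x,y)\ge r$ whenever $x\in U$ and $y\in V$ for distinct members $U\neq V$ of the family. For an integer $k\ge 0$, the *capacity dimension* of $X$ (respectively, the *asymptotic dimension with Higson property* of $X$) is at most $k$ if there is a constant $C>0$ such that for all sufficiently small $r>0$ (respectively, for all sufficiently large $r$) there is a cover $\mathcal U=\bigcup_{i=1}^{k+1}\mathcal U_i$ of $X$ such that each $\mathcal U_i$ is $r$-disjoint and every element of $\mathcal U$ has diameter at most $C\cdot r$; the dimension is finite if it is at most $k$ for some $k$. A metric space $E$ is a *small scale* (respectively, *large scale*) *Lipschitz extensor* of $X$ if there are constants $C,M>0$ such that for every $\lambda>M$ (respectively, every $0\le\lambda<M$), every subset $A\subseteq X$ and every $\lambda$-Lipschitz function $f:A\to E$, there is a $C\lambda$-Lipschitz function $\tilde f:X\to E$ extending $f$. Let $S^n$ be the unit sphere of $\mathbb R^{n+1}$ with the Euclidean metric. **Theorem.** Suppose $X$ is a metric space of finite capacity dimension (respectively, of finite asymptotic dimension with Higson property). If $n\ge 0$, then the following conditions are equivalent: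 (a) $S^n$ is a small scale (respectively, large scale) Lipschitz extensor of $X$. (b) The capacity dimension (respectively, the asymptotic dimension with Higson property) of $X$ is at most $n$. -/

import Mathlib

/-- A family `𝒰` of subsets of a metric space is `r`-disjoint if points lying in two different
members of `𝒰` are at distance at least `r`. -/
def IsRDisjointFamily {X : Type*} [MetricSpace X] (r : ℝ) (𝒰 : Set (Set X)) : Prop :=
  ∀ U ∈ 𝒰, ∀ V ∈ 𝒰, U ≠ V → ∀ x ∈ U, ∀ y ∈ V, r ≤ dist x y

/-- At the scale `r`, the space `X` has a cover that is the union of `n + 1` families, each of them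
`r`-disjoint, and all of whose members have diameter at most `D`. -/
def HasColoredCover (X : Type*) [MetricSpace X] (n : ℕ) (r D : ℝ) : Prop :=
  ∃ 𝒰 : Fin (n + 1) → Set (Set X),
    (∀ x : X, ∃ i, ∃ U ∈ 𝒰 i, x ∈ U) ∧
    (∀ i, IsRDisjointFamily r (𝒰 i)) ∧
    (∀ i, ∀ U ∈ 𝒰 i, ∀ x ∈ U, ∀ y ∈ U, dist x y ≤ D)

/-- The capacity dimension of `X` is at most `n`. -/
def CapacityDimLE (X : Type*) [MetricSpace X] (n : ℕ) : Prop :=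
  ∃ C : ℝ, 0 < C ∧ ∃ r₀ : ℝ, 0 < r₀ ∧ ∀ r : ℝ, 0 < r → r < r₀ → HasColoredCover X n r (C * r)

/-- The asymptotic dimension of `X` with the Higson property (also called asymptotic dimension of
linear type) is at most `n`. -/
def HigsonAsdimLE (X : Type*) [MetricSpace X] (n : ℕ) : Prop :=
  ∃ C : ℝ, 0 < C ∧ ∃ r₀ : ℝ, 0 < r₀ ∧ ∀ r : ℝ, r₀ < r → HasColoredCover X n r (C * r)

open scoped NNReal in
/-- Every `l`-Lipschitz map from a subset of `X` to `E` extends to a `C * l`-Lipschitz map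
from `X` to `E`. -/
def LipschitzExtendsAt (X E : Type*) [MetricSpace X] [MetricSpace E] (C l : ℝ≥0) : Prop :=
  ∀ (A : Set X) (f : A → E), LipschitzWith l f →
    ∃ g : X → E, LipschitzWith (C * l) g ∧ ∀ a : A, g a = f a

open scoped NNReal in
/-- `E` is a small scale Lipschitz extensor of `X`. -/
def IsSmallScaleLipschitzExtensor (E X : Type*) [MetricSpace E] [MetricSpace X] : Prop :=
  ∃ C M : ℝ≥0, 0 < C ∧ 0 < M ∧ ∀ l : ℝ≥0, M < l → LipschitzExtendsAt X E C l

open scoped NNReal in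
/-- `E` is a large scale Lipschitz extensor of `X`. -/
def IsLargeScaleLipschitzExtensor (E X : Type*) [MetricSpace E] [MetricSpace X] : Prop :=
  ∃ C M : ℝ≥0, 0 < C ∧ 0 < M ∧ ∀ l : ℝ≥0, l < M → LipschitzExtendsAt X E C l

/-- The unit sphere `S^n` of Euclidean `(n + 1)`-space, with the metric induced by the
Euclidean one. -/
abbrev UnitSphere (n : ℕ) : Type :=
  Metric.sphere (0 : EuclideanSpace ℝ (Fin (n + 1))) 1

/-! Everything is proved at a single scale. A cover at scale `r` is matched with `l`-Lipschitz maps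
for which `l * r` is a fixed constant, so small `r` means large `l` and conversely, and the two
halves of the theorem follow from the same lemmas.

From covers to extensions (`HasColoredCover.exists_lipschitzExtendsAt`): a map into the sphere first
extends to a Lipschitz map `F` into the ball, which may vanish. Each of the `n + 1` colours carries
a bump function, and on each piece of its support `F` is replaced by a nearby constant. General
position lets these constants be chosen so that constants of different colours are always linearly
independent, uniformly. The weighted average of the constants is then bounded away from `0`;
blending it with `F` near `A` and normalising gives the extension.

From extensions to covers (`HasColoredCover.exists_reduce`): given `k + 2` colours with bumps `φ i`,
consider the set where some `φ i` vanishes. There the differences of the `φ i` do not all vanish, so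
their direction is a Lipschitz map into `S^k`; it extends to `X`. The extension still compares the
colours at every point, and some gap separates a proper nonempty set `J` of top colours from the
rest. The size of `J` takes only `k + 1` values and serves as the new colour.

Suspension (`LipschitzExtendsAt.exists_suspension`) passes the extension property from `S^n` to all
higher spheres, so a finite dimension can be lowered one step at a time down to `n`. -/

/-! ### Vectors in general position -/

theorem Submodule.dense_compl_of_ne_top {V : Type*} [NormedAddCommGroup V] [NormedSpace ℝ V]
    {W : Submodule ℝ V} (hW : W ≠ ⊤) : Dense ((W : Set V)ᶜ) := by
  rw [← interior_eq_empty_iff_dense_compl]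
  by_contra h
  exact hW (W.eq_top_of_nonempty_interior' (Set.nonempty_iff_ne_empty.2 h))

/-- Finitely many vectors can be moved into linearly general position. -/
theorem exists_near_linearIndepOn {V : Type*} [NormedAddCommGroup V] [NormedSpace ℝ V]
    [FiniteDimensional ℝ V] {ι : Type*} [DecidableEq ι] (p : ι → V) {ε : ℝ} (hε : 0 < ε)
    (s : Finset ι) :
    ∃ t : ι → V, (∀ j, ‖t j - p j‖ < ε) ∧
      ∀ S ⊆ s, S.card ≤ Module.finrank ℝ V → LinearIndepOn ℝ t (S : Set ι) := by
  classical
  induction s using Finset.induction_on with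
  | empty =>
    refine ⟨p, fun j => by simpa using hε, fun S hS _ => ?_⟩
    rw [Finset.subset_empty.1 hS]
    simp
  | insert a s ha ih =>
    obtain ⟨t, htp, ht⟩ := ih
    let P : Set (Finset ι) := {S | S ⊆ s ∧ S.card < Module.finrank ℝ V}
    have hP : P.Finite := (s.powerset.finite_toSet).subset fun S hS => by
      simpa using hS.1
    -- The new vector only has to avoid finitely many closed proper subspaces, the spans of fewer
    -- than `finrank ℝ V` earlier vectors. Their complements are open and dense.
    have hd : Dense (⋂ S ∈ P, ((Submodule.span ℝ (t '' (S : Set ι)) : Submodule ℝ V) : Set V)ᶜ) := by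
      refine dense_biInter_of_isOpen (fun S _ => ?_) hP.countable fun S hS => ?_
      · exact (Submodule.closed_of_finiteDimensional _).isOpen_compl
      · refine Submodule.dense_compl_of_ne_top fun h => ?_
        have h1 := finrank_span_finset_le_card (R := ℝ) (S.image t)
        rw [Set.finrank, Finset.coe_image, h, finrank_top] at h1
        exact absurd (h1.trans Finset.card_image_le) (not_le.2 hS.2)
    obtain ⟨v, hv, hvp⟩ := hd.exists_dist_lt (p a) hε
    have hta : ∀ S : Finset ι, a ∉ S → Set.EqOn (Function.update t a v) t (S : Set ι) :=
      fun S hS j hj => Function.update_of_ne (ne_of_mem_of_not_mem hj hS) _ _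
    have key : ∀ S ⊆ s, S.card ≤ Module.finrank ℝ V →
        LinearIndepOn ℝ (Function.update t a v) (S : Set ι) := fun S hS hc =>
      (linearIndepOn_congr (hta S fun h => ha (hS h))).2 (ht S hS hc)
    refine ⟨Function.update t a v, fun j => ?_, fun S hS hc => ?_⟩
    · by_cases h : j = a
      · subst h
        rw [Function.update_self, ← dist_eq_norm, dist_comm]
        exact hvp
      · rw [Function.update_of_ne h]
        exact htp j
    · by_cases h : a ∈ S
      · have hsub : S.erase a ⊆ s := fun j hj => by
          obtain ⟨h1, h2⟩ := Finset.mem_erase.1 hj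
          exact (Finset.mem_insert.1 (hS h2)).resolve_left h1
        have hcard : (S.erase a).card < S.card := Finset.card_erase_lt_of_mem h
        rw [← Finset.insert_erase h, Finset.coe_insert,
          linearIndepOn_insert (by simp)]
        refine ⟨key _ hsub (by omega), ?_⟩
        rw [Function.update_self, (hta (S.erase a) (by simp)).image_eq]
        exact Set.mem_iInter₂.1 hv (S.erase a) ⟨hsub, by omega⟩
      · exact key S (fun j hj => (Finset.mem_insert.1 (hS hj)).resolve_left fun e => h (e ▸ hj)) hc

/-- There are `finrank ℝ V` finite-valued approximations of the identity of the unit ball of `V`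
whose values are uniformly linearly independent. -/
theorem exists_independent_approximations {V : Type*} [NormedAddCommGroup V] [NormedSpace ℝ V]
    [FiniteDimensional ℝ V] {m : ℕ} (hm : Module.finrank ℝ V = m) {ε : ℝ} (hε : 0 < ε) :
    ∃ δ : ℝ, 0 < δ ∧ ∃ T : Fin m → V → V, (∀ i v, ‖v‖ ≤ 1 → ‖T i v - v‖ ≤ ε) ∧
      ∀ v : Fin m → V, (∀ i, ‖v i‖ ≤ 1) → ∀ a : Fin m → ℝ, (∀ i, 0 ≤ a i) →
        δ * ∑ i, a i ≤ ‖∑ i, a i • T i (v i)‖ := by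
  classical
  have hcomp : IsCompact (Metric.closedBall (0 : V) 1) := isCompact_closedBall 0 1
  obtain ⟨Q, -, hQf, hQ⟩ := hcomp.finite_cover_balls (half_pos hε)
  have : Fintype Q := hQf.fintype
  -- The net `Q` is perturbed in `m` separate copies, so that different indices `i` use different
  -- vectors even when they approximate the same point.
  obtain ⟨t, htp, ht⟩ := exists_near_linearIndepOn (fun j : Fin m × Q => (j.2 : V)) (half_pos hε)
    Finset.univ
  have hq : ∀ v : V, ∃ q : V, ‖v‖ ≤ 1 → q ∈ Q ∧ ‖q - v‖ < ε / 2 := fun v => by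
    by_cases hv : ‖v‖ ≤ 1
    · have := hQ (by simpa using hv : v ∈ Metric.closedBall (0 : V) 1)
      simp only [Set.mem_iUnion, Metric.mem_ball, exists_prop] at this
      obtain ⟨q, hq, hd⟩ := this
      exact ⟨q, fun _ => ⟨hq, by rwa [← dist_eq_norm, dist_comm]⟩⟩
    · exact ⟨0, fun h => absurd h hv⟩
  choose q hq using hq
  have hind : ∀ s : Fin m → Q, LinearIndependent ℝ fun i => t (i, s i) := fun s => by
    have hinj : Function.Injective fun i : Fin m => (i, s i) := fun i j h => (Prod.ext_iff.1 h).1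
    have h1 := ht (Finset.univ.image fun i => (i, s i)) (Finset.subset_univ _) (by
      rw [Finset.card_image_of_injective _ hinj, hm]; simp)
    have h2 : LinearIndependent ℝ fun j : ((Finset.univ.image fun i => (i, s i) :
        Finset (Fin m × Q)) : Set (Fin m × Q)) => t j := h1
    exact h2.comp (fun i => ⟨(i, s i), by simp⟩) fun i j h => hinj (Subtype.ext_iff.1 h)
  have hK : ∀ s : Fin m → Q, ∃ K : ℝ, 0 < K ∧ ∀ a : Fin m → ℝ, (∀ i, 0 ≤ a i) →
      ∑ i, a i ≤ K * ‖∑ i, a i • t (i, s i)‖ := fun s => by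
    obtain ⟨K, hK0, hK⟩ := (Fintype.linearCombination ℝ fun i => t (i, s i)).exists_antilipschitzWith
      (LinearMap.ker_eq_bot.2 (linearIndependent_iff_injective_fintypeLinearCombination.1 (hind s)))
    refine ⟨(m + 1) * K, by positivity, fun a ha => ?_⟩
    have h1 := hK.le_mul_dist a 0
    rw [map_zero, dist_zero_right, dist_zero_right, Fintype.linearCombination_apply] at h1
    calc ∑ i, a i ≤ ∑ _i : Fin m, ‖a‖ :=
          Finset.sum_le_sum fun i _ => (le_abs_self _).trans (norm_le_pi_norm a i)
      _ = m * ‖a‖ := by simp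
      _ ≤ (m + 1) * ‖a‖ := by gcongr; linarith
      _ ≤ (m + 1) * (K * ‖∑ i, a i • t (i, s i)‖) := by gcongr
      _ = _ := by ring
  choose K hK0 hK using hK
  have hsum : 0 < 1 + ∑ s, K s := by
    have := Finset.sum_nonneg fun s (_ : s ∈ Finset.univ) => (hK0 s).le
    linarith
  -- There are only finitely many tuples `s` of values, so one constant dominates every `K s`.
  refine ⟨(1 + ∑ s, K s)⁻¹, by positivity, fun i v => if h : q v ∈ Q then t (i, ⟨q v, h⟩) else 0,
    fun i v hv => ?_, fun v hv a ha => ?_⟩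
  · obtain ⟨h1, h2⟩ := hq v hv
    have h3 := htp (i, ⟨q v, h1⟩)
    simp only [h1, dite_true]
    calc ‖t (i, ⟨q v, h1⟩) - v‖ = ‖(t (i, ⟨q v, h1⟩) - q v) + (q v - v)‖ := by congr 1; abel
      _ ≤ _ := norm_add_le _ _
      _ ≤ ε := by linarith
  · let s : Fin m → Q := fun i => ⟨q (v i), (hq _ (hv i)).1⟩
    have h1 : ∀ i, (if h : q (v i) ∈ Q then t (i, ⟨q (v i), h⟩) else 0) = t (i, s i) :=
      fun i => dif_pos (hq _ (hv i)).1
    simp only [h1]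
    rw [inv_mul_le_iff₀ hsum]
    refine (hK s a ha).trans ?_
    gcongr
    have := Finset.single_le_sum (fun s (_ : s ∈ Finset.univ) => (hK0 s).le) (Finset.mem_univ s)
    linarith

/-! ### Bump functions -/

/-- A bump function of Lipschitz constant `1 / r` that equals `1` on `S`. -/
theorem exists_bump {X : Type*} [MetricSpace X] (S : Set X) {r : ℝ} (hr : 0 < r) :
    ∃ φ : X → ℝ, (∀ x, 0 ≤ φ x) ∧ (∀ x, φ x ≤ 1) ∧ (∀ x y, |φ x - φ y| ≤ dist x y / r) ∧
      (∀ x ∈ S, φ x = 1) ∧ ∀ x, 0 < φ x → ∃ y ∈ S, dist x y < r := by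
  rcases S.eq_empty_or_nonempty with rfl | hS
  · exact ⟨fun _ => 0, by simp, by simp, fun x y => by simp; positivity, by simp, by simp⟩
  refine ⟨fun x => max (1 - Metric.infDist x S / r) 0, fun x => le_max_right _ _, fun x => ?_,
    fun x y => ?_, fun x hx => ?_, fun x hx => ?_⟩
  · have : 0 ≤ Metric.infDist x S / r := div_nonneg Metric.infDist_nonneg hr.le
    exact max_le (by linarith) zero_le_one
  · refine (abs_max_sub_max_le_abs _ _ _).trans ?_
    have h := (Metric.lipschitz_infDist_pt S).dist_le_mul x y
    rw [NNReal.coe_one, one_mul, Real.dist_eq] at h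
    rw [show 1 - Metric.infDist x S / r - (1 - Metric.infDist y S / r) =
      -((Metric.infDist x S - Metric.infDist y S) / r) by ring, abs_neg, abs_div, abs_of_pos hr]
    gcongr
  · simp [Metric.infDist_zero_of_mem hx]
  · have h1 : 0 < 1 - Metric.infDist x S / r := by
      exact (lt_max_iff.1 hx).resolve_right (lt_irrefl _)
    have h2 : Metric.infDist x S < r := by
      rwa [sub_pos, div_lt_one hr] at h1
    exact (Metric.infDist_lt_iff hS).1 h2

/-- A bump function of an `r`-disjoint family of sets of diameter at most `D`, and a choice of a
point near the supporting member of the family that is locally constant on the support. -/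
theorem IsRDisjointFamily.exists_bump {X : Type*} [MetricSpace X] {𝒰 : Set (Set X)} {r D : ℝ}
    (hr : 0 < r) (hU : IsRDisjointFamily r 𝒰) (hD : ∀ U ∈ 𝒰, ∀ x ∈ U, ∀ y ∈ U, dist x y ≤ D) :
    ∃ (φ : X → ℝ) (ρ : X → X), (∀ x, 0 ≤ φ x) ∧ (∀ x, φ x ≤ 1) ∧
      (∀ x y, |φ x - φ y| ≤ 3 / r * dist x y) ∧ (∀ U ∈ 𝒰, ∀ x ∈ U, φ x = 1) ∧
      (∀ x, 0 < φ x → dist x (ρ x) ≤ D + r / 3) ∧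
      ∀ x y, 0 < φ x → 0 < φ y → dist x y < r / 3 → ρ x = ρ y := by
  obtain ⟨φ, h0, h1, hL, hS, hn⟩ := _root_.exists_bump (⋃₀ 𝒰) (show 0 < r / 3 by positivity)
  have hn' : ∀ x, ∃ U : Set X, 0 < φ x → U ∈ 𝒰 ∧ ∃ y ∈ U, dist x y < r / 3 := fun x => by
    by_cases hx : 0 < φ x
    · obtain ⟨y, ⟨U, hU, hy⟩, hxy⟩ := hn x hx
      exact ⟨U, fun _ => ⟨hU, y, hy, hxy⟩⟩
    · exact ⟨∅, fun h => absurd h hx⟩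
  choose τ hτ using hn'
  -- The chosen point depends on `U` alone. It is encoded as a constant map, which does not require
  -- `X` to be inhabited; `id` is a dummy value for empty `U`.
  have hc : ∀ U : Set X, ∃ c : X → X, U.Nonempty → (∀ x y, c x = c y) ∧ ∀ x, c x ∈ U := fun U => by
    by_cases h : U.Nonempty
    · exact ⟨fun _ => h.some, fun _ => ⟨fun _ _ => rfl, fun _ => h.some_mem⟩⟩
    · exact ⟨id, fun h' => absurd h' h⟩
  choose c hc using hc
  refine ⟨φ, fun x => c (τ x) x, h0, h1, fun x y => ?_, fun U hU' x hx => hS x ⟨U, hU', hx⟩,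
    fun x hx => ?_, fun x y hx hy hxy => ?_⟩
  · refine (hL x y).trans (le_of_eq ?_)
    field_simp
  · obtain ⟨hU', y, hy, hxy⟩ := hτ x hx
    have := hD _ hU' y hy _ ((hc (τ x) ⟨y, hy⟩).2 x)
    linarith [dist_triangle x y (c (τ x) x)]
  · obtain ⟨hU1, x', hx', hxx⟩ := hτ x hx
    obtain ⟨hU2, y', hy', hyy⟩ := hτ y hy
    -- Three distances below `r / 3` join the two members, so `r`-disjointness forces them to
    -- coincide.
    have he : τ x = τ y := by
      by_contra hne
      have := hU _ hU1 _ hU2 hne _ hx' _ hy'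
      linarith [dist_triangle4 x' x y y', dist_comm x x']
    show c (τ x) x = c (τ y) y
    rw [← he]
    exact (hc (τ x) ⟨x', hx'⟩).1 x y

/-! ### Lipschitz estimates and maps into balls and spheres -/

/-- This quotient rule serves for normalisation, for the retraction onto the ball and for division
by the sum of the bumps. The bound on `w / t` makes it independent of the size of `t`. -/
theorem norm_inv_smul_sub_inv_smul_le {V : Type*} [NormedAddCommGroup V] [NormedSpace ℝ V]
    {m R s t : ℝ} {v w : V} (hm : 0 < m) (hs : m ≤ s) (ht : m ≤ t) (hw : ‖w‖ ≤ R * t) :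
    ‖s⁻¹ • v - t⁻¹ • w‖ ≤ m⁻¹ * (‖v - w‖ + R * |s - t|) := by
  have hs0 : 0 < s := hm.trans_le hs
  have ht0 : 0 < t := hm.trans_le ht
  have e : s⁻¹ • v - t⁻¹ • w = s⁻¹ • ((v - w) + ((t - s) * t⁻¹) • w) := by
    rw [smul_add, smul_smul, smul_sub]
    have : s⁻¹ * ((t - s) * t⁻¹) = s⁻¹ - t⁻¹ := by field_simp
    rw [this, sub_smul]
    abel
  rw [e, norm_smul, norm_inv, Real.norm_of_nonneg hs0.le]
  have h1 : ‖((t - s) * t⁻¹) • w‖ ≤ R * |s - t| := by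
    rw [norm_smul, norm_mul, norm_inv, Real.norm_of_nonneg ht0.le, Real.norm_eq_abs, abs_sub_comm]
    calc |s - t| * t⁻¹ * ‖w‖ ≤ |s - t| * t⁻¹ * (R * t) := by gcongr
      _ = _ := by field_simp
  have h2 : ‖v - w + ((t - s) * t⁻¹) • w‖ ≤ ‖v - w‖ + R * |s - t| :=
    (norm_add_le _ _).trans (by linarith)
  have h3 : 0 ≤ ‖v - w‖ + R * |s - t| := (norm_nonneg _).trans h2
  calc s⁻¹ * ‖v - w + ((t - s) * t⁻¹) • w‖ ≤ s⁻¹ * (‖v - w‖ + R * |s - t|) := by gcongr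
    _ ≤ _ := by gcongr

theorem norm_normalize_sub_normalize_le {V : Type*} [NormedAddCommGroup V] [NormedSpace ℝ V]
    {m : ℝ} {v w : V} (hm : 0 < m) (hv : m ≤ ‖v‖) (hw : m ≤ ‖w‖) :
    ‖‖v‖⁻¹ • v - ‖w‖⁻¹ • w‖ ≤ 2 / m * ‖v - w‖ := by
  refine (norm_inv_smul_sub_inv_smul_le (R := 1) hm hv hw (by simp)).trans ?_
  have := abs_norm_sub_norm_le v w
  calc m⁻¹ * (‖v - w‖ + 1 * |‖v‖ - ‖w‖|) ≤ m⁻¹ * (‖v - w‖ + 1 * ‖v - w‖) := by gcongr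
    _ = _ := by ring

theorem norm_smul_sub_smul_le {V : Type*} [NormedAddCommGroup V] [NormedSpace ℝ V]
    (s t : ℝ) (v w : V) : ‖s • v - t • w‖ ≤ |s| * ‖v - w‖ + |s - t| * ‖w‖ := by
  rw [show s • v - t • w = s • (v - w) + (s - t) • w by rw [smul_sub, sub_smul]; abel]
  refine (norm_add_le _ _).trans (le_of_eq ?_)
  rw [norm_smul, norm_smul, Real.norm_eq_abs, Real.norm_eq_abs]

/-- The Lipschitz estimate for a pointwise convex combination `c • v + (1 - c) • w`. -/
theorem norm_convexComb_sub_le {V : Type*} [NormedAddCommGroup V] [NormedSpace ℝ V]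
    {c c' : ℝ} {v v' w w' : V} (h0 : 0 ≤ c) (h1 : c ≤ 1) :
    ‖(c • v + (1 - c) • w) - (c' • v' + (1 - c') • w')‖ ≤
      ‖v - v'‖ + ‖w - w'‖ + |c - c'| * ‖v' - w'‖ := by
  rw [show (c • v + (1 - c) • w) - (c' • v' + (1 - c') • w') =
    c • (v - v') + (1 - c) • (w - w') + (c - c') • (v' - w') by module]
  refine norm_add₃_le.trans ?_
  rw [norm_smul, norm_smul, norm_smul, Real.norm_of_nonneg h0,
    Real.norm_of_nonneg (sub_nonneg.2 h1), Real.norm_eq_abs]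
  have := norm_nonneg (v - v')
  have := norm_nonneg (w - w')
  nlinarith

/-- Lipschitz maps into the unit sphere extend to Lipschitz maps into the unit ball. -/
theorem exists_lipschitz_ball_extension (n : ℕ) :
    ∃ K : ℝ, 0 < K ∧ ∀ {X : Type*} [MetricSpace X] {l : NNReal} {A : Set X}
      {f : A → UnitSphere n}, LipschitzWith l f →
      ∃ F : X → EuclideanSpace ℝ (Fin (n + 1)), (∀ x, ‖F x‖ ≤ 1) ∧
        (∀ x y, ‖F x - F y‖ ≤ K * l * dist x y) ∧ ∀ a : A, F a = f a := by
  let K₀ : NNReal := lipschitzExtensionConstant (EuclideanSpace ℝ (Fin (n + 1)))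
  refine ⟨2 * (K₀ + 1), by positivity, fun {X _ l A f} hf => ?_⟩
  let f₀ : X → EuclideanSpace ℝ (Fin (n + 1)) := Function.extend Subtype.val (fun a => (f a).1) 0
  have hf₀ : ∀ a : A, f₀ a = f a := fun a => Subtype.val_injective.extend_apply _ _ a
  have hL : LipschitzOnWith l f₀ A := by
    refine LipschitzOnWith.of_dist_le_mul fun x hx y hy => ?_
    rw [hf₀ ⟨x, hx⟩, hf₀ ⟨y, hy⟩]
    exact hf.dist_le_mul ⟨x, hx⟩ ⟨y, hy⟩
  obtain ⟨G, hG, hGf⟩ := hL.extend_finite_dimension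
  have hm : ∀ x, 0 < max ‖G x‖ 1 := fun x => lt_max_of_lt_right one_pos
  refine ⟨fun x => (max ‖G x‖ 1)⁻¹ • G x, fun x => ?_, fun x y => ?_, fun a => ?_⟩
  · rw [norm_smul, norm_inv, Real.norm_of_nonneg (hm x).le, inv_mul_le_iff₀ (hm x), mul_one]
    exact le_max_left _ _
  · have h1 := hG.dist_le_mul x y
    rw [dist_eq_norm, NNReal.coe_mul] at h1
    have h2 : |max ‖G x‖ 1 - max ‖G y‖ 1| ≤ ‖G x - G y‖ :=
      (abs_max_sub_max_le_abs _ _ _).trans (abs_norm_sub_norm_le _ _)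
    refine (norm_inv_smul_sub_inv_smul_le (R := 1) one_pos (le_max_right _ _) (le_max_right _ _)
      (by rw [one_mul]; exact le_max_left _ _)).trans ?_
    have h3 : 0 ≤ (l : ℝ) * dist x y := by positivity
    have h4 : ((lipschitzExtensionConstant (EuclideanSpace ℝ (Fin (n + 1))) : NNReal) : ℝ) = K₀ :=
      rfl
    rw [h4] at h1
    nlinarith
  · have h : ‖G a‖ = 1 := by rw [← hGf a.2, hf₀]; exact norm_eq_of_mem_sphere (f a)
    simp only [h, max_self, inv_one, one_smul]
    rw [← hGf a.2, hf₀]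

theorem EuclideanSpace.norm_le_sum_abs {ι : Type*} [Fintype ι] (v : EuclideanSpace ℝ ι) :
    ‖v‖ ≤ ∑ i, |v i| := by
  rw [EuclideanSpace.norm_eq]
  refine Real.sqrt_le_iff.2 ⟨Finset.sum_nonneg fun i _ => abs_nonneg _, ?_⟩
  exact Finset.sum_sq_le_sq_sum_of_nonneg fun i _ => abs_nonneg _

/-- Normalising a map that extends `f` and stays away from `0` gives an extension of `f` to a
Lipschitz map into the sphere. -/
theorem exists_sphere_extension_of_norm_ge {X : Type*} [MetricSpace X] {n : ℕ} {A : Set X}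
    {f : A → UnitSphere n} {G : X → EuclideanSpace ℝ (Fin (n + 1))} {m : ℝ} {L K : NNReal}
    (hm : 0 < m) (hGm : ∀ x, m ≤ ‖G x‖) (hG : ∀ x y, ‖G x - G y‖ ≤ L * dist x y)
    (hGf : ∀ a : A, G a = f a) (hK : 2 / m * L ≤ K) :
    ∃ g : X → UnitSphere n, LipschitzWith K g ∧ ∀ a : A, g a = f a := by
  have h0 : ∀ x, 0 < ‖G x‖ := fun x => hm.trans_le (hGm x)
  refine ⟨fun x => ⟨‖G x‖⁻¹ • G x, ?_⟩, LipschitzWith.of_dist_le_mul fun x y => ?_, fun a => ?_⟩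
  · rw [mem_sphere_zero_iff_norm, norm_smul, norm_inv, norm_norm, inv_mul_cancel₀ (h0 x).ne']
  · rw [Subtype.dist_eq, dist_eq_norm]
    refine (norm_normalize_sub_normalize_le hm (hGm x) (hGm y)).trans ?_
    calc 2 / m * ‖G x - G y‖ ≤ 2 / m * (L * dist x y) := by gcongr; exact hG x y
      _ = 2 / m * L * dist x y := by ring
      _ ≤ _ := by gcongr
  · apply Subtype.ext
    simp only [hGf a, norm_eq_of_mem_sphere, inv_one, one_smul]

/-! ### Suspension -/

/-- The first `n` coordinates of a point of Euclidean `(n + 1)`-space. -/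
def EuclideanSpace.init {n : ℕ} (v : EuclideanSpace ℝ (Fin (n + 1))) : EuclideanSpace ℝ (Fin n) :=
  WithLp.toLp 2 fun i => v i.castSucc

/-- The point of Euclidean `(n + 1)`-space with first coordinates `h` and last coordinate `t`. -/
def EuclideanSpace.snoc {n : ℕ} (h : EuclideanSpace ℝ (Fin n)) (t : ℝ) :
    EuclideanSpace ℝ (Fin (n + 1)) :=
  WithLp.toLp 2 (Fin.snoc (α := fun _ => ℝ) h.ofLp t)

namespace EuclideanSpace

variable {n : ℕ}

theorem norm_sq_eq_init_add_last (v : EuclideanSpace ℝ (Fin (n + 1))) :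
    ‖v‖ ^ 2 = ‖init v‖ ^ 2 + v (Fin.last n) ^ 2 := by
  rw [EuclideanSpace.real_norm_sq_eq, EuclideanSpace.real_norm_sq_eq, Fin.sum_univ_castSucc]
  rfl

theorem norm_init_le (v : EuclideanSpace ℝ (Fin (n + 1))) : ‖init v‖ ≤ ‖v‖ :=
  abs_le_of_sq_le_sq' (by nlinarith [norm_sq_eq_init_add_last v]) (norm_nonneg _) |>.2

theorem abs_apply_le_norm {ι : Type*} [Fintype ι] (v : EuclideanSpace ℝ ι) (i : ι) :
    |v i| ≤ ‖v‖ :=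
  PiLp.norm_apply_le v i

theorem snoc_init_last (v : EuclideanSpace ℝ (Fin (n + 1))) :
    snoc (init v) (v (Fin.last n)) = v := by
  ext i
  refine Fin.lastCases ?_ (fun j => ?_) i <;> simp [snoc, init]

theorem norm_snoc_sq (h : EuclideanSpace ℝ (Fin n)) (t : ℝ) : ‖snoc h t‖ ^ 2 = ‖h‖ ^ 2 + t ^ 2 := by
  rw [norm_sq_eq_init_add_last]
  congr 2
  · congr 1
    ext i
    simp [snoc, init]
  · simp [snoc]

theorem snoc_sub (h h' : EuclideanSpace ℝ (Fin n)) (t t' : ℝ) :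
    snoc h t - snoc h' t' = snoc (h - h') (t - t') := by
  ext i
  refine Fin.lastCases ?_ (fun j => ?_) i <;> simp [snoc]

theorem norm_snoc_le (h : EuclideanSpace ℝ (Fin n)) (t : ℝ) : ‖snoc h t‖ ≤ ‖h‖ + |t| :=
  abs_le_of_sq_le_sq' (by nlinarith [norm_snoc_sq h t, sq_abs t, norm_nonneg h, abs_nonneg t])
    (by positivity) |>.2

theorem le_norm_snoc {h : EuclideanSpace ℝ (Fin n)} {t m : ℝ} (hm : m ≤ ‖h‖ ∨ m ≤ |t|) :
    m ≤ ‖snoc h t‖ := by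
  have h1 := norm_snoc_sq h t
  rcases hm with hm | hm
  · exact hm.trans (abs_le_of_sq_le_sq' (by nlinarith) (norm_nonneg _)).2
  · exact hm.trans (abs_le_of_sq_le_sq' (by nlinarith [sq_abs t]) (norm_nonneg _)).2

end EuclideanSpace

/-- If `S^n` is a Lipschitz extensor, so is `S^{n+1}`. -/
theorem LipschitzExtendsAt.exists_suspension (n : ℕ) (C : NNReal) :
    ∃ C' : NNReal, 0 < C' ∧ ∀ {X : Type*} [MetricSpace X] {l : NNReal},
      LipschitzExtendsAt X (UnitSphere n) C (4 * l) →
        LipschitzExtendsAt X (UnitSphere (n + 1)) C' l := by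
  obtain ⟨K, hK0, hK⟩ := exists_lipschitz_ball_extension (n + 1)
  lift K to NNReal using hK0.le
  refine ⟨8 * (11 * K + 4 * C), ?_, fun {X _ l} hX A f hf => ?_⟩
  · have : 0 < K := hK0
    positivity
  obtain ⟨F, hF1, hFL, hFf⟩ := hK hf
  set T : X → ℝ := fun x => F x (Fin.last (n + 1)) with hT
  set F' : X → EuclideanSpace ℝ (Fin (n + 1)) := fun x => (F x).init with hF'
  have hTL : ∀ x y, |T x - T y| ≤ K * l * dist x y := fun x y =>
    (EuclideanSpace.abs_apply_le_norm (F x - F y) (Fin.last (n + 1))).trans (hFL x y)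
  have hF'L : ∀ x y, ‖F' x - F' y‖ ≤ K * l * dist x y := fun x y =>
    (EuclideanSpace.norm_init_le (F x - F y)).trans (hFL x y)
  have hF'1 : ∀ x, ‖F' x‖ ≤ 1 := fun x => (EuclideanSpace.norm_init_le (F x)).trans (hF1 x)
  have hsq : ∀ x, ‖F x‖ ^ 2 = ‖F' x‖ ^ 2 + T x ^ 2 := fun x =>
    EuclideanSpace.norm_sq_eq_init_add_last (F x)
  -- the equatorial part of the domain
  let B : Set X := {x | x ∈ A ∧ |T x| ≤ 1 / 2}
  have hBn : ∀ x ∈ B, 1 / 2 ≤ ‖F' x‖ := fun x hx => by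
    have h1 := hsq x
    have h2 : ‖F x‖ = 1 := by rw [hFf ⟨x, hx.1⟩]; exact norm_eq_of_mem_sphere _
    rw [h2] at h1
    have h3 := hx.2
    have h4 : T x ^ 2 ≤ (1 / 2) ^ 2 := sq_le_sq.2 (by rwa [abs_of_pos (by norm_num : (0:ℝ) < 1 / 2)])
    exact abs_le_of_sq_le_sq' (by nlinarith) (norm_nonneg _) |>.2
  have hBu : ∀ b : B, ‖F' b‖⁻¹ • F' b ∈ Metric.sphere (0 : EuclideanSpace ℝ (Fin (n + 1))) 1 :=
    fun b => by
      have := hBn b b.2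
      rw [mem_sphere_zero_iff_norm, norm_smul, norm_inv, norm_norm, inv_mul_cancel₀ (by linarith)]
  let u : B → UnitSphere n := fun b => ⟨‖F' b‖⁻¹ • F' b, hBu b⟩
  -- On `A` the map `F` is `f`, hence `l`-Lipschitz without the factor `K`; normalising vectors of
  -- norm at least `1 / 2` costs a factor `4`.
  have hu : LipschitzWith (4 * l) u := LipschitzWith.of_dist_le_mul fun x y => by
    rw [Subtype.dist_eq, dist_eq_norm]
    have h1 := hf.dist_le_mul ⟨x, x.2.1⟩ ⟨y, y.2.1⟩
    rw [Subtype.dist_eq, dist_eq_norm, ← hFf ⟨x, x.2.1⟩, ← hFf ⟨y, y.2.1⟩] at h1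
    have h2 : ‖F' x - F' y‖ ≤ l * dist x y := (EuclideanSpace.norm_init_le (F x - F y)).trans h1
    refine (norm_normalize_sub_normalize_le (m := 1 / 2) (by norm_num) (hBn x x.2)
      (hBn y y.2)).trans ?_
    push_cast
    linarith
  obtain ⟨g, hg, hgu⟩ := hX B u hu
  have hgL : ∀ x y, ‖(g x : EuclideanSpace ℝ (Fin (n + 1))) - g y‖ ≤ 4 * C * l * dist x y :=
    fun x y => by
      have := hg.dist_le_mul x y
      rw [Subtype.dist_eq, dist_eq_norm] at this
      push_cast at this
      linarith
  have hg1 : ∀ x, ‖(g x : EuclideanSpace ℝ (Fin (n + 1)))‖ = 1 := fun x => norm_eq_of_mem_sphere _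
  let s : X → ℝ := fun x => max ‖F' x‖ (1 / 2)
  have hs0 : ∀ x, 1 / 2 ≤ s x := fun x => le_max_right _ _
  have hs1 : ∀ x, |s x| ≤ 1 := fun x => by
    rw [abs_of_nonneg (by linarith [hs0 x])]
    exact max_le (hF'1 x) (by norm_num)
  have hsL : ∀ x y, |s x - s y| ≤ K * l * dist x y := fun x y =>
    (abs_max_sub_max_le_abs _ _ _).trans ((abs_norm_sub_norm_le _ _).trans (hF'L x y))
  -- The cutoff is `0` where `|T| ≤ 1 / 4` and `1` where `|T| ≥ 1 / 2`. In the first region `h` has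
  -- norm `s ≥ 1 / 2`; outside it the height `T` alone keeps the result away from `0`.
  let χ : X → ℝ := fun x => min (max (4 * |T x| - 1) 0) 1
  have hχ0 : ∀ x, 0 ≤ χ x := fun x => le_min (le_max_right _ _) zero_le_one
  have hχ1 : ∀ x, χ x ≤ 1 := fun x => min_le_right _ _
  have hχL : ∀ x y, |χ x - χ y| ≤ 4 * (K * l * dist x y) := fun x y => by
    have h1 : |χ x - χ y| ≤ |max (4 * |T x| - 1) 0 - max (4 * |T y| - 1) 0| := by
      simpa using abs_min_sub_min_le_max (max (4 * |T x| - 1) 0) 1 (max (4 * |T y| - 1) 0) 1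
    refine h1.trans ((abs_max_sub_max_le_abs _ _ _).trans ?_)
    rw [show 4 * |T x| - 1 - (4 * |T y| - 1) = 4 * (|T x| - |T y|) by ring, abs_mul,
      abs_of_pos (by norm_num : (0 : ℝ) < 4)]
    gcongr
    exact (abs_abs_sub_abs_le_abs_sub _ _).trans (hTL x y)
  let h : X → EuclideanSpace ℝ (Fin (n + 1)) := fun x =>
    χ x • F' x + (1 - χ x) • (s x • (g x : EuclideanSpace ℝ (Fin (n + 1))))
  have hsgL : ∀ x y, ‖s x • (g x : EuclideanSpace ℝ (Fin (n + 1))) -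
      s y • (g y : EuclideanSpace ℝ (Fin (n + 1)))‖ ≤ (K + 4 * C) * l * dist x y := fun x y => by
    refine (norm_smul_sub_smul_le _ _ _ _).trans ?_
    rw [hg1 y, mul_one]
    have h1 := mul_le_mul (hs1 x) (hgL x y) (norm_nonneg _) zero_le_one
    linarith [hsL x y]
  have hhL : ∀ x y, ‖h x - h y‖ ≤ (10 * K + 4 * C) * l * dist x y := fun x y => by
    refine (norm_convexComb_sub_le (hχ0 x) (hχ1 x)).trans ?_
    have h1 : ‖F' y - s y • (g y : EuclideanSpace ℝ (Fin (n + 1)))‖ ≤ 2 := by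
      refine (norm_sub_le _ _).trans ?_
      rw [norm_smul, hg1, mul_one, Real.norm_eq_abs]
      linarith [hF'1 y, hs1 y]
    have h2 := mul_le_mul (hχL x y) h1 (norm_nonneg _) (by positivity)
    linarith [hF'L x y, hsgL x y]
  refine exists_sphere_extension_of_norm_ge (G := fun x => EuclideanSpace.snoc (h x) (T x))
    (m := 1 / 4) (L := (11 * K + 4 * C) * l) (by norm_num) (fun x => ?_) (fun x y => ?_)
    (fun a => ?_) ?_
  · refine EuclideanSpace.le_norm_snoc ?_
    rcases le_total (1 / 4) |T x| with hx | hx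
    · exact Or.inr hx
    · left
      have h1 : χ x = 0 := by
        simp only [χ]
        rw [max_eq_right (by linarith), min_eq_left zero_le_one]
      simp only [h, h1, zero_smul, zero_add, sub_zero, one_smul, norm_smul, hg1, mul_one,
        Real.norm_eq_abs]
      linarith [hs0 x, le_abs_self (s x)]
  · rw [EuclideanSpace.snoc_sub]
    refine (EuclideanSpace.norm_snoc_le _ _).trans ?_
    push_cast
    linarith [hhL x y, hTL x y]
  · have key : h a = F' a := by
      rcases le_total |T a| (1 / 2) with ha | ha
      · have h1 : (a : X) ∈ B := ⟨a.2, ha⟩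
        have h2 : s a = ‖F' a‖ := max_eq_left (hBn a h1)
        have h3 : (g a : EuclideanSpace ℝ (Fin (n + 1))) = ‖F' a‖⁻¹ • F' a := by
          rw [hgu ⟨a, h1⟩]
        have h4 : ‖F' a‖ ≠ 0 := by linarith [hBn a h1]
        simp only [h, h2, h3, smul_inv_smul₀ h4]
        module
      · have h1 : χ a = 1 := by
          simp only [χ]
          rw [min_eq_right]
          exact le_max_of_le_left (by linarith)
        simp [h, h1]
    simp only [key]
    rw [← hFf a]
    exact EuclideanSpace.snoc_init_last (F a)
  · push_cast
    apply le_of_eq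
    ring

/-! ### From coloured covers to extensions -/

/-- A coloured cover by `n + 1` families allows to extend Lipschitz maps into `S^n`. -/
theorem HasColoredCover.exists_lipschitzExtendsAt (n : ℕ) {C : ℝ} (hC : 0 < C) :
    ∃ (c : ℝ) (C' : NNReal), 0 < c ∧ 0 < C' ∧ ∀ {X : Type*} [MetricSpace X] {r : ℝ} {l : NNReal},
      0 < r → l * r = c → HasColoredCover X n r (C * r) →
        LipschitzExtendsAt X (UnitSphere n) C' l := by
  obtain ⟨K, hK0, hK⟩ := exists_lipschitz_ball_extension n
  obtain ⟨δ, hδ, T, hT, hTδ⟩ := exists_independent_approximations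
    (V := EuclideanSpace ℝ (Fin (n + 1))) (m := n + 1) (by simp) (show (0 : ℝ) < 1 / 8 by norm_num)
  -- With this `c`, `F` varies by at most `1 / 8` over distances up to `(C + 1 / 3) * r` and up to
  -- `r`. The first is the distance to the chosen point `ρ i x`.
  set c : ℝ := 1 / (8 * K * (C + 4 / 3)) with hc
  have hc0 : 0 < c := by positivity
  have hKc' : K * c * (C + 4 / 3) = 1 / 8 := by rw [hc]; field_simp
  have hKcC : K * c * (C + 1 / 3) ≤ 1 / 8 := by nlinarith [mul_pos hK0 hc0]
  have hKc : K * c ≤ 1 / 8 := by nlinarith [mul_pos hK0 hc0]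
  set m : ℝ := min δ (1 / 2) with hm
  have hm0 : 0 < m := by positivity
  set L : ℝ := 19 * (n + 1) with hL
  have hL0 : 0 < L := by positivity
  refine ⟨c, (2 / m * (L / c)).toNNReal, hc0, Real.toNNReal_pos.2 (by positivity),
    fun {X _ r l} hr hlr hcov A f hf => ?_⟩
  rcases A.eq_empty_or_nonempty with rfl | -
  · exact ⟨fun _ => ⟨EuclideanSpace.single 0 1, by simp⟩,
      LipschitzWith.const' _, fun a => a.2.elim⟩
  obtain ⟨F, hF1, hFL, hFf⟩ := hK hf
  have hlc : (l : ℝ) = c / r := by rw [← hlr]; field_simp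
  have hFL' : ∀ x y, ‖F x - F y‖ ≤ K * c * (dist x y / r) := fun x y => by
    refine (hFL x y).trans (le_of_eq ?_)
    rw [hlc]; ring
  obtain ⟨𝒰, hU, hUd, hUD⟩ := hcov
  choose φ ρ hφ0 hφ1 hφL hφU hρ hρeq using fun i => (hUd i).exists_bump hr (hUD i)
  let Φ : X → ℝ := fun x => ∑ i, φ i x
  have hΦ1 : ∀ x, 1 ≤ Φ x := fun x => by
    obtain ⟨i, U, hUi, hx⟩ := hU x
    rw [← hφU i U hUi x hx]
    exact Finset.single_le_sum (f := fun i => φ i x) (fun i _ => hφ0 i x) (Finset.mem_univ i)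
  let τ : Fin (n + 1) → X → EuclideanSpace ℝ (Fin (n + 1)) := fun i x => T i (F (ρ i x))
  have hτ2 : ∀ i x, ‖τ i x‖ ≤ 2 := fun i x => by
    have h1 := hT i (F (ρ i x)) (hF1 _)
    have h2 := norm_le_norm_add_norm_sub (F (ρ i x)) (τ i x)
    rw [norm_sub_rev] at h2
    linarith [hF1 (ρ i x)]
  let N : X → EuclideanSpace ℝ (Fin (n + 1)) := fun x => ∑ i, φ i x • τ i x
  have hN2 : ∀ x, ‖N x‖ ≤ 2 * Φ x := fun x => by
    refine (norm_sum_le _ _).trans ?_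
    rw [Finset.mul_sum]
    refine Finset.sum_le_sum fun i _ => ?_
    rw [norm_smul, Real.norm_of_nonneg (hφ0 i x)]
    nlinarith [hτ2 i x, hφ0 i x]
  -- `T i` need not be continuous, but `τ i` can jump between points at distance less than `r / 3`
  -- only if one of them is a zero of `φ i`. For points farther apart the trivial bound `4`
  -- suffices.
  have hterm : ∀ i x y, ‖φ i x • τ i x - φ i y • τ i y‖ ≤ 12 * (dist x y / r) := fun i x y => by
    have hL' : |φ i x - φ i y| ≤ 3 * (dist x y / r) := (hφL i x y).trans (le_of_eq (by ring))
    have hd : 0 ≤ dist x y / r := by positivity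
    rcases (hφ0 i x).eq_or_lt with hx | hx
    · rw [← hx, zero_sub, abs_neg, abs_of_nonneg (hφ0 i y)] at hL'
      rw [← hx, zero_smul, zero_sub, norm_neg, norm_smul, Real.norm_of_nonneg (hφ0 i y)]
      nlinarith [hτ2 i y, hφ0 i y]
    rcases (hφ0 i y).eq_or_lt with hy | hy
    · rw [← hy, sub_zero, abs_of_nonneg (hφ0 i x)] at hL'
      rw [← hy, zero_smul, sub_zero, norm_smul, Real.norm_of_nonneg (hφ0 i x)]
      nlinarith [hτ2 i x, hφ0 i x]
    rcases lt_or_ge (dist x y) (r / 3) with h | h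
    · have : τ i x = τ i y := by simp only [τ, hρeq i x y hx hy h]
      rw [this, ← sub_smul, norm_smul, Real.norm_eq_abs]
      nlinarith [hτ2 i y, norm_nonneg (τ i y), abs_nonneg (φ i x - φ i y)]
    · have h1 : 1 / 3 ≤ dist x y / r := by rw [le_div_iff₀ hr]; linarith
      refine (norm_sub_le _ _).trans ?_
      rw [norm_smul, norm_smul, Real.norm_of_nonneg hx.le, Real.norm_of_nonneg hy.le]
      nlinarith [hτ2 i y, hτ2 i x, hφ1 i x, hφ1 i y, norm_nonneg (τ i y), norm_nonneg (τ i x)]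
  have hNL : ∀ x y, ‖N x - N y‖ ≤ 12 * (n + 1) * (dist x y / r) := fun x y => by
    simp only [N, ← Finset.sum_sub_distrib]
    refine (norm_sum_le _ _).trans ((Finset.sum_le_sum fun i _ => hterm i x y).trans (le_of_eq ?_))
    simp; ring
  have hΦL : ∀ x y, |Φ x - Φ y| ≤ 3 * (n + 1) * (dist x y / r) := fun x y => by
    simp only [Φ, ← Finset.sum_sub_distrib]
    refine (Finset.abs_sum_le_sum_abs _ _).trans
      ((Finset.sum_le_sum fun i _ => hφL i x y).trans (le_of_eq ?_))
    simp; ring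
  let g : X → EuclideanSpace ℝ (Fin (n + 1)) := fun x => (Φ x)⁻¹ • N x
  have hgL : ∀ x y, ‖g x - g y‖ ≤ 18 * (n + 1) * (dist x y / r) := fun x y => by
    refine (norm_inv_smul_sub_inv_smul_le one_pos (hΦ1 x) (hΦ1 y) (hN2 y)).trans ?_
    rw [inv_one, one_mul]
    linarith [hNL x y, hΦL x y]
  have hgδ : ∀ x, δ ≤ ‖g x‖ := fun x => by
    have h0 : 0 < Φ x := one_pos.trans_le (hΦ1 x)
    rw [norm_smul, norm_inv, Real.norm_of_nonneg h0.le, le_inv_mul_iff₀ h0, mul_comm]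
    exact hTδ (fun i => F (ρ i x)) (fun i => hF1 _) (fun i => φ i x) fun i => hφ0 i x
  have hgF : ∀ x, ‖F x - g x‖ ≤ 1 / 4 := fun x => by
    have h0 : 0 < Φ x := one_pos.trans_le (hΦ1 x)
    have e : F x - g x = (Φ x)⁻¹ • ∑ i, φ i x • (F x - τ i x) := by
      simp only [smul_sub, Finset.sum_sub_distrib, ← Finset.sum_smul]
      rw [inv_smul_smul₀ h0.ne']
    rw [e, norm_smul, norm_inv, Real.norm_of_nonneg h0.le, inv_mul_le_iff₀ h0, mul_comm,
      Finset.mul_sum]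
    refine (norm_sum_le _ _).trans (Finset.sum_le_sum fun i _ => ?_)
    rw [norm_smul, Real.norm_of_nonneg (hφ0 i x), mul_comm]
    rcases (hφ0 i x).eq_or_lt with hx | hx
    · simp [← hx]
    gcongr
    have h1 := hT i (F (ρ i x)) (hF1 _)
    have h2 : dist x (ρ i x) / r ≤ C + 1 / 3 := by
      rw [div_le_iff₀ hr]
      linarith [hρ i x hx]
    have h3 := hFL' x (ρ i x)
    have h4 : K * c * (dist x (ρ i x) / r) ≤ K * c * (C + 1 / 3) := by gcongr
    have h5 := norm_sub_le_norm_sub_add_norm_sub (F x) (F (ρ i x)) (τ i x)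
    rw [norm_sub_rev (F (ρ i x))] at h5
    linarith
  obtain ⟨χ, hχ0, hχ1, hχL, hχA, hχn⟩ := exists_bump A hr
  refine exists_sphere_extension_of_norm_ge (G := fun x => χ x • F x + (1 - χ x) • g x)
    (m := m) (L := (L / r).toNNReal) hm0 (fun x => ?_) (fun x y => ?_)
    (fun a => ?_) ?_
  · rcases (hχ0 x).eq_or_lt with hx | hx
    · simp only [← hx, zero_smul, zero_add, sub_zero, one_smul]
      exact (min_le_left _ _).trans (hgδ x)
    · obtain ⟨a, ha, hxa⟩ := hχn x hx
      have h1 : ‖F a‖ = 1 := by rw [hFf ⟨a, ha⟩]; exact norm_eq_of_mem_sphere _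
      have h2 : dist x a / r ≤ 1 := by rw [div_le_one hr]; exact hxa.le
      have h3 := hFL' a x
      rw [dist_comm] at h3
      have h4 : K * c * (dist x a / r) ≤ K * c * 1 := by gcongr
      -- Near `A` the norm of `F` is at least `7 / 8`, and blending with `g` loses at most `1 / 4`.
      have h5 := norm_le_norm_add_norm_sub' (F a) (F x)
      have h6 : F x = (χ x • F x + (1 - χ x) • g x) + (1 - χ x) • (F x - g x) := by module
      have h7 := norm_add_le (χ x • F x + (1 - χ x) • g x) ((1 - χ x) • (F x - g x))
      rw [← h6, norm_smul, Real.norm_of_nonneg (sub_nonneg.2 (hχ1 x))] at h7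
      have h8 : (1 - χ x) * ‖F x - g x‖ ≤ 1 * (1 / 4) := by
        gcongr
        · linarith
        · exact hgF x
      have h9 : m ≤ 1 / 2 := min_le_right _ _
      linarith
  · refine (norm_convexComb_sub_le (hχ0 x) (hχ1 x)).trans ?_
    have h1 : |χ x - χ y| * ‖F y - g y‖ ≤ dist x y / r * (1 / 4) :=
      mul_le_mul (hχL x y) (hgF y) (norm_nonneg _) (by positivity)
    have hd : 0 ≤ dist x y / r := by positivity
    have h2 : K * c * (dist x y / r) ≤ 1 / 8 * (dist x y / r) := by gcongr
    rw [Real.coe_toNNReal _ (by positivity), show L / r * dist x y = L * (dist x y / r) by ring, hL]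
    have h3 : 0 ≤ (n : ℝ) * (dist x y / r) := by positivity
    linarith [hFL' x y, hgL x y]
  · simp [hχA a a.2, hFf]
  · rw [NNReal.coe_mul, Real.coe_toNNReal _ (by positivity), Real.coe_toNNReal _ (by positivity),
      hlc]
    apply le_of_eq
    field_simp

/-! ### From extensions to covers with fewer colours -/

/-- If a finite family of reals takes two values at distance `δ`, then it has a gap of size
`δ / card ι`. -/
theorem exists_finset_gap {ι : Type*} [Fintype ι] [DecidableEq ι] (e : ι → ℝ) {δ : ℝ} (hδ : 0 < δ)
    {i j : ι} (hij : δ ≤ e i - e j) :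
    ∃ J : Finset ι, i ∈ J ∧ j ∉ J ∧ ∀ p ∈ J, ∀ q ∉ J, δ / Fintype.card ι ≤ e p - e q := by
  set N := Fintype.card ι with hN
  have hN0 : 0 < N := Fintype.card_pos_iff.2 ⟨i⟩
  have hN0' : (0 : ℝ) < N := Nat.cast_pos.2 hN0
  set η : ℝ := δ / N with hη
  have hη0 : 0 < η := by positivity
  have hηN : N * η = δ := by rw [hη]; field_simp
  -- Pigeonhole: if each of the `N` open intervals above `e j` contained a value, all `N` indices
  -- would be used up, but `e j` itself lies in none of them.
  have key : ∃ s : Fin N, ∀ p, ¬ (e j + s * η < e p ∧ e p < e j + (s + 1) * η) := by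
    by_contra! h
    choose p hp using h
    have hlt : ∀ s t : Fin N, p s = p t → (s : ℝ) < t + 1 := fun s t hst => by
      have h1 := (hp s).1
      have h2 := (hp t).2
      rw [hst] at h1
      by_contra! h3
      nlinarith
    have hinj : Function.Injective p := fun s t hst => by
      have h1 := hlt s t hst
      have h2 := hlt t s hst.symm
      ext
      have h1' : (s : ℕ) < t + 1 := by exact_mod_cast h1
      have h2' : (t : ℕ) < s + 1 := by exact_mod_cast h2
      omega
    have hsurj := ((Fintype.bijective_iff_injective_and_card p).2 ⟨hinj, by simp [hN]⟩).2
    obtain ⟨s, hs⟩ := hsurj j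
    have h1 := (hp s).1
    rw [hs] at h1
    have : (0 : ℝ) ≤ s * η := by positivity
    linarith
  obtain ⟨s, hs⟩ := key
  have hs0 : (0 : ℝ) ≤ s * η := by positivity
  have hsN : (s + 1 : ℝ) * η ≤ δ := by
    rw [← hηN]
    gcongr
    exact_mod_cast s.2
  refine ⟨Finset.univ.filter fun p => e j + (s + 1) * η ≤ e p, ?_, ?_, fun p hp q hq => ?_⟩
  · simp only [Finset.mem_filter, Finset.mem_univ, true_and]
    linarith
  · simp only [Finset.mem_filter, Finset.mem_univ, true_and, not_le]
    linarith
  · simp only [Finset.mem_filter, Finset.mem_univ, true_and, not_le] at hp hq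
    have h1 : e q ≤ e j + s * η := by
      by_contra! h
      exact hs q ⟨h, hq⟩
    linarith

/-- If `S^k` is a Lipschitz extensor, a coloured cover by `k + 2` families can be replaced
by one by `k + 1` families. -/
theorem HasColoredCover.exists_reduce (k : ℕ) (C : NNReal) {D : ℝ} (hD : 0 < D) :
    ∃ c c' C' : ℝ, 0 < c ∧ 0 < c' ∧ 0 < C' ∧ ∀ {X : Type*} [MetricSpace X] {r : ℝ} {l : NNReal},
      0 < r → l * r = c → HasColoredCover X (k + 1) r (D * r) →
        LipschitzExtendsAt X (UnitSphere k) C l → HasColoredCover X k (c' * r) (C' * (c' * r)) := by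
  -- A unit vector has a coordinate of size at least `1 / (k + 1)`; with a zero appended there are
  -- `k + 2` values, hence a gap of at least `η`.
  set η : ℝ := 1 / (k + 1) / (k + 2) with hη
  have hη0 : 0 < η := by positivity
  set c : ℝ := 24 * (k + 1) with hc
  have hc0 : 0 < c := by positivity
  -- The bound `1 / 3` makes `ρ` agree at nearby points; the other bound keeps each coordinate of
  -- `e` from moving by `η`. Using `C + 1` avoids a zero denominator.
  set c' : ℝ := min (1 / 3) (η / ((C + 1) * c)) with hc'
  have hc'0 : 0 < c' := lt_min (by norm_num) (by positivity)
  refine ⟨c, c', 2 * (D + 1 / 3) / c', hc0, hc'0, by positivity, fun {X _ r l} hr hlr hcov hX => ?_⟩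
  have hlc : (l : ℝ) = c / r := by rw [← hlr]; field_simp
  obtain ⟨𝒰, hU, hUd, hUD⟩ := hcov
  choose φ ρ hφ0 hφ1 hφL hφU hρ hρeq using fun i => (hUd i).exists_bump hr (hUD i)
  let A : Set X := {x | ∃ i, φ i x = 0}
  let a : X → EuclideanSpace ℝ (Fin (k + 1)) := fun x =>
    WithLp.toLp 2 fun i => φ i.castSucc x - φ (Fin.last _) x
  have haL : ∀ x y, ‖a x - a y‖ ≤ 6 * (k + 1) / r * dist x y := fun x y => by
    refine (EuclideanSpace.norm_le_sum_abs _).trans ?_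
    have h1 : ∀ i, |(a x - a y) i| ≤ 6 / r * dist x y := fun i => by
      have e : (a x - a y) i = (φ i.castSucc x - φ i.castSucc y) -
          (φ (Fin.last _) x - φ (Fin.last _) y) := by simp [a]; ring
      rw [e]
      refine (abs_sub _ _).trans ((add_le_add (hφL _ x y) (hφL _ x y)).trans (le_of_eq ?_))
      ring
    refine (Finset.sum_le_sum fun i _ => h1 i).trans (le_of_eq ?_)
    simp; ring
  have hexp : ∀ (v : EuclideanSpace ℝ (Fin (k + 1))) (i : Fin (k + 2)),
      |Fin.snoc (α := fun _ => ℝ) v.ofLp 0 i| ≤ ‖v‖ := fun v i => by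
    refine Fin.lastCases ?_ (fun j => ?_) i
    · simp
    · simpa using PiLp.norm_apply_le v j
  have hasn : ∀ x i, Fin.snoc (α := fun _ => ℝ) (a x).ofLp 0 i = φ i x - φ (Fin.last _) x :=
    fun x i => by refine Fin.lastCases ?_ (fun j => ?_) i <;> simp [a]
  -- Some bump equals `1` and another `0`, so one of the two differs from the last bump by at least
  -- `1 / 2`.
  have haA : ∀ x ∈ A, 1 / 2 ≤ ‖a x‖ := fun x hx => by
    obtain ⟨i, hi⟩ := hx
    obtain ⟨j, U, hUj, hxU⟩ := hU x
    have h1 := hφU j U hUj x hxU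
    have h2 := hexp (a x) i
    have h3 := hexp (a x) j
    rw [hasn, hi] at h2
    rw [hasn, h1] at h3
    linarith [le_abs_self (1 - φ (Fin.last _) x), neg_abs_le (0 - φ (Fin.last _) x)]
  have hAu : ∀ b : A, ‖a b‖⁻¹ • a b ∈ Metric.sphere (0 : EuclideanSpace ℝ (Fin (k + 1))) 1 :=
    fun b => by
      have := haA b b.2
      rw [mem_sphere_zero_iff_norm, norm_smul, norm_inv, norm_norm, inv_mul_cancel₀ (by linarith)]
  obtain ⟨g, hg, hgu⟩ := hX A (fun b => ⟨‖a b‖⁻¹ • a b, hAu b⟩) <|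
    LipschitzWith.of_dist_le_mul fun x y => by
      rw [Subtype.dist_eq, dist_eq_norm]
      refine (norm_normalize_sub_normalize_le (m := 1 / 2) (by norm_num) (haA x x.2)
        (haA y y.2)).trans ?_
      have := haL x y
      rw [hlc, hc, Subtype.dist_eq]
      calc 2 / (1 / 2) * ‖a x - a y‖ ≤ 2 / (1 / 2) * (6 * (k + 1) / r * dist (x : X) y) := by gcongr
        _ = _ := by ring
  let e : X → Fin (k + 2) → ℝ := fun x =>
    Fin.snoc (α := fun _ => ℝ) (g x : EuclideanSpace ℝ (Fin (k + 1))).ofLp 0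
  have heL : ∀ x y i, |e x i - e y i| ≤ C * (c / r) * dist x y := fun x y i => by
    have h1 : e x i - e y i = Fin.snoc (α := fun _ => ℝ)
        ((g x : EuclideanSpace ℝ (Fin (k + 1))) - g y).ofLp 0 i := by
      refine Fin.lastCases ?_ (fun j => ?_) i <;> simp [e]
    rw [h1]
    have h2 := hg.dist_le_mul x y
    rw [Subtype.dist_eq, dist_eq_norm, NNReal.coe_mul, hlc] at h2
    exact (hexp _ i).trans h2
  -- On `A` the order of the `e x i` is that of the `φ i x`, so a top colour has a bump above a
  -- nonnegative one; off `A` all bumps are positive.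
  have hφpos : ∀ x (J : Finset (Fin (k + 2))) (i : Fin (k + 2)), i ∉ J →
      (∀ p ∈ J, ∀ q ∉ J, η ≤ e x p - e x q) → ∀ p ∈ J, 0 < φ p x := fun x J i hi hJ p hp => by
    by_cases hx : x ∈ A
    · have h1 : ∀ i, e x i = ‖a x‖⁻¹ * (φ i x - φ (Fin.last _) x) := fun i => by
        have h2 : (g x : EuclideanSpace ℝ (Fin (k + 1))) = ‖a x‖⁻¹ • a x := by rw [hgu ⟨x, hx⟩]
        rw [← hasn]
        simp only [e, h2]
        refine Fin.lastCases ?_ (fun j => ?_) i <;> simp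
      have h2 := hJ p hp i hi
      rw [h1, h1, ← mul_sub] at h2
      have h3 : 0 < ‖a x‖⁻¹ := inv_pos.2 (by linarith [haA x hx])
      have h4 : 0 < φ p x - φ (Fin.last _) x - (φ i x - φ (Fin.last _) x) :=
        pos_of_mul_pos_right (hη0.trans_le h2) h3.le
      linarith [hφ0 i x]
    · exact (hφ0 p x).lt_of_ne fun h => hx ⟨p, h.symm⟩
  let V : Finset (Fin (k + 2)) → (Fin (k + 2) → X) → Set X := fun J p =>
    {x | (∀ j ∈ J, ∀ i ∉ J, η ≤ e x j - e x i) ∧ ∀ j ∈ J, ρ j x = p j}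
  have hproper : ∀ (i : Fin (k + 1)) (J : Finset (Fin (k + 2))), J.card = i + 1 →
      (∃ j, j ∈ J) ∧ ∃ j, j ∉ J := fun i J hJ => by
    refine ⟨Finset.card_pos.1 (by omega), ?_⟩
    by_contra! h
    have := Finset.card_fin (k + 2)
    rw [← Finset.eq_univ_iff_forall.2 h] at this
    omega
  refine ⟨fun i => {W | ∃ J p, J.card = (i : ℕ) + 1 ∧ W = V J p}, fun x => ?_, fun i => ?_, fun i => ?_⟩
  · have h1 : ∃ i, 1 / (k + 1 : ℝ) ≤ |(g x : EuclideanSpace ℝ (Fin (k + 1))) i| := by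
      by_contra! h
      have h2 := EuclideanSpace.norm_le_sum_abs (g x : EuclideanSpace ℝ (Fin (k + 1)))
      have h3 := Finset.sum_lt_sum_of_nonempty (Finset.univ_nonempty (α := Fin (k + 1)))
        fun i _ => h i
      rw [norm_eq_of_mem_sphere] at h2
      have h4 : ∑ _i : Fin (k + 1), 1 / (k + 1 : ℝ) = 1 := by
        simp; field_simp
      linarith
    have h2 : ∃ p q, 1 / (k + 1 : ℝ) ≤ e x p - e x q := by
      obtain ⟨i, hi⟩ := h1
      rcases le_abs.1 hi with h | h
      · exact ⟨i.castSucc, Fin.last _, by simpa [e] using h⟩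
      · exact ⟨Fin.last _, i.castSucc, by simpa [e] using h⟩
    obtain ⟨p, q, hpq⟩ := h2
    obtain ⟨J, hp, hq, hJ⟩ := exists_finset_gap (e x) (by positivity) hpq
    have h3 : 0 < J.card := Finset.card_pos.2 ⟨p, hp⟩
    have h4 : J.card < k + 2 := by
      simpa using Finset.card_lt_univ_of_notMem hq
    refine ⟨⟨J.card - 1, by omega⟩, V J fun j => ρ j x, ⟨J, _, ?_, rfl⟩, ?_, fun j _ => rfl⟩
    · simp only; omega
    · intro j hj i hi
      have := hJ j hj i hi
      simpa [hη] using this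
  · rintro _ ⟨J, p, hJ, rfl⟩ _ ⟨J', p', hJ', rfl⟩ hne x hx y hy
    by_contra! hlt
    obtain ⟨-, i₀, hi₀⟩ := hproper i J hJ
    by_cases hJJ : J = J'
    · subst hJJ
      refine hne ?_
      have hd : dist x y < r / 3 := by
        have : c' * r ≤ 1 / 3 * r := by gcongr; exact min_le_left _ _
        linarith
      have hp : ∀ j ∈ J, p j = p' j := fun j hj => by
        rw [← hx.2 j hj, ← hy.2 j hj]
        exact hρeq j x y (hφpos x J i₀ hi₀ hx.1 j hj) (hφpos y J i₀ hi₀ hy.1 j hj) hd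
      ext z
      exact and_congr_right fun _ => forall₂_congr fun j hj => by rw [hp j hj]
    -- Distinct sets of equal size each have an element outside the other. Then `e s - e t` would
    -- fall from at least `η` to at most `-η`, too much for nearby points.
    · obtain ⟨s, hs, hs'⟩ : ∃ s ∈ J, s ∉ J' := by
        by_contra! h
        exact hJJ (Finset.eq_of_subset_of_card_le h (by omega))
      obtain ⟨t, ht', ht⟩ : ∃ t ∈ J', t ∉ J := by
        by_contra! h
        exact hJJ (Finset.eq_of_subset_of_card_le h (by omega)).symm
      have h1 := hx.1 s hs t ht
      have h2 := hy.1 t ht' s hs'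
      have h3 := (le_abs_self _).trans (heL x y s)
      have h4 := (neg_abs_le (e x t - e y t)).trans' (neg_le_neg (heL x y t))
      have h5 : C * (c / r) * dist x y < η := by
        have h6 : c' ≤ η / ((C + 1) * c) := min_le_right _ _
        rw [le_div_iff₀ (by positivity)] at h6
        have h7 : dist x y / r < c' := by rw [div_lt_iff₀ hr]; exact hlt
        have h8 : (0 : ℝ) ≤ dist x y / r := by positivity
        calc C * (c / r) * dist x y = C * c * (dist x y / r) := by ring
          _ ≤ (C + 1) * c * (dist x y / r) := by gcongr; linarith
          _ < (C + 1) * c * c' := by gcongr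
          _ ≤ η := by linarith
      linarith
  · rintro _ ⟨J, p, hJ, rfl⟩ x hx y hy
    obtain ⟨⟨j, hj⟩, i₀, hi₀⟩ := hproper i J hJ
    have h1 := hρ j x (hφpos x J i₀ hi₀ hx.1 j hj)
    have h2 := hρ j y (hφpos y J i₀ hi₀ hy.1 j hj)
    rw [hx.2 j hj] at h1
    rw [hy.2 j hj] at h2
    have e1 : 2 * (D + 1 / 3) / c' * (c' * r) = 2 * (D * r + r / 3) := by field_simp
    rw [e1]
    linarith [dist_triangle_right x y (p j)]

/-! ### Passing to all small or all large scales -/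

theorem HasColoredCover.mono {X : Type*} [MetricSpace X] {m n : ℕ} (hmn : m ≤ n) {r D : ℝ}
    (h : HasColoredCover X m r D) : HasColoredCover X n r D := by
  obtain ⟨𝒰, hU, hUd, hUD⟩ := h
  refine ⟨fun i => if hi : (i : ℕ) < m + 1 then 𝒰 ⟨i, hi⟩ else ∅, fun x => ?_, fun i => ?_,
    fun i => ?_⟩
  · obtain ⟨i, U, hUi, hx⟩ := hU x
    exact ⟨⟨i, by omega⟩, U, by dsimp only; rwa [dif_pos i.2], hx⟩
  · dsimp only
    split_ifs with hi
    · exact hUd _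
    · intro U hU
      exact hU.elim
  · dsimp only
    split_ifs with hi
    · exact hUD _
    · intro U hU
      exact hU.elim

theorem IsSmallScaleLipschitzExtensor.add {X : Type*} [MetricSpace X] {n : ℕ}
    (h : IsSmallScaleLipschitzExtensor (UnitSphere n) X) (j : ℕ) :
    IsSmallScaleLipschitzExtensor (UnitSphere (n + j)) X := by
  induction j with
  | zero => exact h
  | succ j ih =>
    obtain ⟨C, M, -, hM, hX⟩ := ih
    obtain ⟨C', hC', hs⟩ := LipschitzExtendsAt.exists_suspension (n + j) C
    exact ⟨C', M, hC', hM, fun l hl => hs (hX _ (hl.trans_le (le_mul_of_one_le_left' (by norm_num))))⟩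

theorem IsLargeScaleLipschitzExtensor.add {X : Type*} [MetricSpace X] {n : ℕ}
    (h : IsLargeScaleLipschitzExtensor (UnitSphere n) X) (j : ℕ) :
    IsLargeScaleLipschitzExtensor (UnitSphere (n + j)) X := by
  induction j with
  | zero => exact h
  | succ j ih =>
    obtain ⟨C, M, -, hM, hX⟩ := ih
    obtain ⟨C', hC', hs⟩ := LipschitzExtendsAt.exists_suspension (n + j) C
    -- Suspension calls the lower sphere at `4 * l`, which must stay below `M`; at small scale the
    -- factor `4` is harmless.
    refine ⟨C', M / 4, hC', by positivity, fun l hl => hs (hX _ ?_)⟩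
    rw [lt_div_iff₀ (by norm_num)] at hl
    rwa [mul_comm]

theorem CapacityDimLE.isSmallScaleLipschitzExtensor {X : Type*} [MetricSpace X] {n : ℕ}
    (h : CapacityDimLE X n) : IsSmallScaleLipschitzExtensor (UnitSphere n) X := by
  obtain ⟨C, hC, r₀, hr₀, hX⟩ := h
  obtain ⟨c, C', hc, hC', hE⟩ := HasColoredCover.exists_lipschitzExtendsAt n hC
  refine ⟨C', (c / r₀).toNNReal, hC', Real.toNNReal_pos.2 (by positivity), fun l hl => ?_⟩
  have hl' : c / r₀ < l := (Real.toNNReal_lt_iff_lt_coe (by positivity)).1 hl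
  have hl0 : (0 : ℝ) < l := (by positivity : 0 < c / r₀).trans hl'
  have hr : c / l < r₀ := by rwa [div_lt_iff₀ hl0, mul_comm, ← div_lt_iff₀ hr₀]
  exact hE (div_pos hc hl0) (by field_simp) (hX _ (div_pos hc hl0) hr)

theorem HigsonAsdimLE.isLargeScaleLipschitzExtensor {X : Type*} [MetricSpace X] {n : ℕ}
    (h : HigsonAsdimLE X n) : IsLargeScaleLipschitzExtensor (UnitSphere n) X := by
  obtain ⟨C, hC, r₀, hr₀, hX⟩ := h
  obtain ⟨c, C', hc, hC', hE⟩ := HasColoredCover.exists_lipschitzExtendsAt n hC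
  refine ⟨C', (c / r₀).toNNReal, hC', Real.toNNReal_pos.2 (by positivity), fun l hl => ?_⟩
  -- No scale `c / l` corresponds to `l = 0`, but then `f` is constant.
  rcases eq_or_ne l 0 with rfl | hl0
  · intro A f hf
    rcases isEmpty_or_nonempty A with hA | ⟨⟨a⟩⟩
    · exact ⟨fun _ => ⟨EuclideanSpace.single 0 1, by simp⟩, LipschitzWith.const' _,
        fun a => (hA.false a).elim⟩
    · refine ⟨fun _ => f a, LipschitzWith.const' _, fun b => ?_⟩
      have := hf.dist_le_mul a b
      rw [NNReal.coe_zero, zero_mul] at this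
      exact dist_le_zero.1 this
  have hl' : (l : ℝ) < c / r₀ := Real.lt_toNNReal_iff_coe_lt.1 hl
  have hl0 : (0 : ℝ) < l := NNReal.coe_pos.2 (pos_iff_ne_zero.2 hl0)
  have hr : r₀ < c / l := by rwa [lt_div_iff₀ hl0, mul_comm, ← lt_div_iff₀ hr₀]
  exact hE (div_pos hc hl0) (by field_simp) (hX _ hr)

theorem CapacityDimLE.of_succ {X : Type*} [MetricSpace X] {k : ℕ} (h : CapacityDimLE X (k + 1))
    (hS : IsSmallScaleLipschitzExtensor (UnitSphere k) X) : CapacityDimLE X k := by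
  obtain ⟨D, hD, r₀, hr₀, hX⟩ := h
  obtain ⟨C, M, -, hM, hE⟩ := hS
  obtain ⟨c, c', C', hc, hc', hC', hR⟩ := HasColoredCover.exists_reduce k C hD
  have hM' : (0 : ℝ) < M := hM
  refine ⟨C', hC', c' * min r₀ (c / M), by positivity, fun r hr hlt => ?_⟩
  have h1 : r / c' < min r₀ (c / M) := by rwa [div_lt_iff₀ hc', mul_comm]
  have h0 : 0 < r / c' := by positivity
  have h2 : (M : ℝ) < c / (r / c') := by
    have := h1.trans_le (min_le_right _ _)
    rwa [lt_div_iff₀ hM', mul_comm, ← lt_div_iff₀ h0] at this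
  have h3 := hR (X := X) (r := r / c') (l := (c / (r / c')).toNNReal) h0
    (by rw [Real.coe_toNNReal _ (by positivity)]; field_simp)
    (hX _ h0 (h1.trans_le (min_le_left _ _))) (hE _ (Real.lt_toNNReal_iff_coe_lt.2 h2))
  rwa [mul_div_cancel₀ _ hc'.ne'] at h3

theorem HigsonAsdimLE.of_succ {X : Type*} [MetricSpace X] {k : ℕ} (h : HigsonAsdimLE X (k + 1))
    (hS : IsLargeScaleLipschitzExtensor (UnitSphere k) X) : HigsonAsdimLE X k := by
  obtain ⟨D, hD, r₀, hr₀, hX⟩ := h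
  obtain ⟨C, M, -, hM, hE⟩ := hS
  obtain ⟨c, c', C', hc, hc', hC', hR⟩ := HasColoredCover.exists_reduce k C hD
  have hM' : (0 : ℝ) < M := hM
  refine ⟨C', hC', c' * max r₀ (c / M), by positivity, fun r hlt => ?_⟩
  have h1 : max r₀ (c / M) < r / c' := by rwa [lt_div_iff₀ hc', mul_comm]
  have h0 : 0 < r / c' := hr₀.trans ((le_max_left _ _).trans_lt h1)
  have h2 : c / (r / c') < (M : ℝ) := by
    have := (le_max_right _ _).trans_lt h1
    rwa [div_lt_iff₀ hM', mul_comm, ← div_lt_iff₀ h0] at this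
  have h3 := hR (X := X) (r := r / c') (l := (c / (r / c')).toNNReal) h0
    (by rw [Real.coe_toNNReal _ (by positivity)]; exact div_mul_cancel₀ _ h0.ne')
    (hX _ ((le_max_left _ _).trans_lt h1))
    (hE _ ((Real.toNNReal_lt_iff_lt_coe (by positivity)).2 h2))
  rwa [mul_div_cancel₀ _ hc'.ne'] at h3

/-- The bound is first weakened to `n + k`, so that each step down meets a sphere `S^(n + j)` that
is an extensor by suspension. -/
theorem CapacityDimLE.of_isSmallScaleLipschitzExtensor {X : Type*} [MetricSpace X] {k n : ℕ}
    (h : CapacityDimLE X k) (hS : IsSmallScaleLipschitzExtensor (UnitSphere n) X) :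
    CapacityDimLE X n := by
  have h' : CapacityDimLE X (n + k) := by
    obtain ⟨C, hC, r₀, hr₀, hX⟩ := h
    exact ⟨C, hC, r₀, hr₀, fun r hr hlt => (hX r hr hlt).mono (by omega)⟩
  clear h
  induction k with
  | zero => exact h'
  | succ k ih => exact ih (CapacityDimLE.of_succ h' (hS.add k))

theorem HigsonAsdimLE.of_isLargeScaleLipschitzExtensor {X : Type*} [MetricSpace X] {k n : ℕ}
    (h : HigsonAsdimLE X k) (hS : IsLargeScaleLipschitzExtensor (UnitSphere n) X) :
    HigsonAsdimLE X n := by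
  have h' : HigsonAsdimLE X (n + k) := by
    obtain ⟨C, hC, r₀, hr₀, hX⟩ := h
    exact ⟨C, hC, r₀, hr₀, fun r hlt => (hX r hlt).mono (by omega)⟩
  clear h
  induction k with
  | zero => exact h'
  | succ k ih => exact ih (HigsonAsdimLE.of_succ h' (hS.add k))

theorem mainTheorem2 (X : Type*) [MetricSpace X] (n : ℕ) :
    ((∃ k : ℕ, CapacityDimLE X k) →
      (IsSmallScaleLipschitzExtensor (UnitSphere n) X ↔ CapacityDimLE X n)) ∧
    ((∃ k : ℕ, HigsonAsdimLE X k) →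
      (IsLargeScaleLipschitzExtensor (UnitSphere n) X ↔ HigsonAsdimLE X n)) :=
  ⟨fun ⟨_, hk⟩ => ⟨fun hS => hk.of_isSmallScaleLipschitzExtensor hS,
      fun h => h.isSmallScaleLipschitzExtensor⟩,
    fun ⟨_, hk⟩ => ⟨fun hS => hk.of_isLargeScaleLipschitzExtensor hS,
      fun h => h.isLargeScaleLipschitzExtensor⟩⟩
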